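/- Let $\mathcal X$ be a measurable space, $\mathcal H$ a set of functions $\mathcal X\to\{0,1\}$ and $\chi:\mathcal H\times\mathcal X\to[0,1]$ (the compatibility). Put $\chi_h=\chi(h,\cdot)$ and $\chi(\mathcal H)=\{\chi_h:h\in\mathcal H\}$, and let $\mathrm{VCdim}(\chi(\mathcal H))<\infty$ be the VC dimension of the subgraphs of the functions in $\chi(\mathcal H)$ (the pseudo-dimension; it is the usual VC dimension if $\chi$ is $\{0,1\}$-valued). For a probability measure $P$ on $\mathcal X$ and a target $c^*\in\mathcal H$ let $err(h)=\Pr_{x\sim P}[h(x)\neq c^*(x)]$ and $\chi(h,P)=\mathbb E_{x\sim P}[\chi(h,x)]$, and define $t$ by $\chi(c^*,P)=1-t$. For $\tau\in\mathbb R$ let $\mathcal H_{P,\chi}(\tau)=\{h\in\mathcal H:\chi(h,P)>1-\tau\}$, and let $\mathcal H_{P,\chi}(\tau)[n,P]$ be the expected number of distinct labelings of $n$ i.i.d. points from $P$ by hypotheses in $\mathcal H_{P,\chi}(\tau)$. Assume that all $h$ and $\chi_h$, $h\in\mathcal H$, are measurable and, as usual for uncountable classes, that for every $n$ the set of samples $(x_1,\dots,x_n)\in\mathcal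 X^n$ for which some $h\in\mathcal H$ satisfies a given open condition on $(h(x_i),\chi(h,x_i))_{i\le n}$, $err(h)$ and $\chi(h,P)$ is $P^n$-measurable (measurable up to null sets). There is a universal constant $C>0$ such that the following holds for all $\mathcal X,\mathcal H,\chi,P,c^*$ as above and all $\epsilon,\delta>0$. Let $m_u,m_l$ be natural numbers with $$m_u\ \ge\ C\left(\frac{\mathrm{VCdim}(\chi(\mathcal H))}{\epsilon^2}\log\frac1\epsilon+\frac1{\epsilon^2}\log\frac2\delta\right),\qquad m_l\ \ge\ \frac2\epsilon\left[\ln\bigl(2\,\mathcal H_{P,\chi}(t+2\epsilon)[2m_l,P]\bigr)+\ln\frac4\delta\right].$$ Draw an unlabeled sample $S$ of $m_u$ i.i.d. points from $P$ and, independently, $m_l$ i.i.d. points from $P$ labeled by $c^*$. Let $\hat\chi(h,S)=\frac1{|S|}\sum_{x\in S}\chi(h,x)$, let $\widehat{err}(h)$ be the fraction of labeled examples on which $h$ is wrong, and let $\mathcal H_0=\{h\in\mathcal H:\widehat{err}(h)=0\}$. Then: 1. these sample sizes suffice to learn to error $\epsilon$ with probability $1-\delta$: there is a learning rule, which depends on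 $\mathcal H,\chi,\epsilon,\delta,m_u,m_l$ but not on $P$, $c^*$ or $t$, that maps the two samples to a hypothesis and, with probability at least $1-\delta$, outputs some $h\in\mathcal H_0$ with $err(h)\le\epsilon$; 2. in particular, with probability at least $1-\delta$, every $\hat h\in\arg\max_{h\in\mathcal H_0}\hat\chi(h,S)$ satisfies $err(\hat h)\le\epsilon$. -/

import Mathlib

open MeasureTheory

namespace SSL

noncomputable section

/-- A finite set `s` of points is shattered by a class `F` of real-valued functions if, for some
thresholds `r`, every subset `b` of `s` is cut out by some `f ∈ F`:
`f` exceeds the threshold exactly at the points of `b`. -/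
def Shatters {X : Type*} (F : Set (X → ℝ)) (s : Finset X) : Prop :=
  ∃ r : X → ℝ, ∀ b ⊆ s, ∃ f ∈ F, ∀ x ∈ s, (x ∈ b ↔ r x < f x)

/-- The VC dimension of a class of real-valued functions (the VC dimension of its subgraphs, also
called the pseudo-dimension). For `{0,1}`-valued classes it is the usual VC dimension, see
`shatters_iff_of_zero_one`. -/
def VCdim {X : Type*} (F : Set (X → ℝ)) : ℕ∞ :=
  ⨆ (s : Finset X) (_ : Shatters F s), (s.card : ℕ∞)

/-- For `{0,1}`-valued functions, shattering is the usual set-theoretic notion. -/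
theorem shatters_iff_of_zero_one {X : Type*} (F : Set (X → ℝ))
    (hF : ∀ f ∈ F, ∀ x, f x = 0 ∨ f x = 1) (s : Finset X) :
    Shatters F s ↔ ∀ b ⊆ s, ∃ f ∈ F, ∀ x ∈ s, (x ∈ b ↔ f x = 1) := by
  constructor
  · rintro ⟨r, hr⟩ b hb
    obtain ⟨f, hf, hfb⟩ := hr b hb
    obtain ⟨g, hg, hgb⟩ := hr ∅ (Finset.empty_subset s)
    obtain ⟨k, hk, hkb⟩ := hr s (Finset.Subset.refl s)
    refine ⟨f, hf, fun x hx => ?_⟩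
    have h0 : ¬ r x < g x := fun h => by simpa using (hgb x hx).2 h
    have h1 : r x < k x := (hkb x hx).1 hx
    rw [hfb x hx]
    rcases hF f hf x with h | h <;> rcases hF g hg x with h' | h' <;>
      rcases hF k hk x with h'' | h'' <;> rw [h] <;> rw [h'] at h0 <;> rw [h''] at h1 <;>
      constructor <;> intro h3 <;> linarith
  · intro H
    refine ⟨fun _ => 1 / 2, fun b hb => ?_⟩
    obtain ⟨f, hf, hfb⟩ := H b hb
    refine ⟨f, hf, fun x hx => ?_⟩
    rw [hfb x hx]
    rcases hF f hf x with h | h <;> rw [h] <;> norm_num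

/-- The true error rate `err(h) = Pr_{x ∼ P}[h(x) ≠ c(x)]` with respect to the target `c`. -/
def err {X : Type*} [MeasurableSpace X] (P : Measure X) (c h : X → Bool) : ℝ :=
  P.real {x | h x ≠ c x}

/-- The expected compatibility `χ(h, P) = E_{x ∼ P}[χ(h, x)]`. -/
def compat {X : Type*} [MeasurableSpace X] (P : Measure X) (χ : (X → Bool) → X → ℝ)
    (h : X → Bool) : ℝ :=
  ∫ x, χ h x ∂P

/-- The empirical error rate of `h` on a labeled sample `L`. -/
def empErr {X : Type*} {m : ℕ} (L : Fin m → X × Bool) (h : X → Bool) : ℝ :=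
  (∑ i, if h (L i).1 ≠ (L i).2 then (1 : ℝ) else 0) / m

/-- The empirical compatibility of `h` on an unlabeled sample `S`. -/
def empCompat {X : Type*} {m : ℕ} (χ : (X → Bool) → X → ℝ) (S : Fin m → X) (h : X → Bool) : ℝ :=
  (∑ i, χ h (S i)) / m

/-- The sample `x` labeled by the target `c`. -/
def labelBy {X : Type*} {m : ℕ} (c : X → Bool) (x : Fin m → X) : Fin m → X × Bool :=
  fun i => (x i, c (x i))

/-- `H₀`: the hypotheses in `H` with zero empirical error on `L`. -/
def consistent {X : Type*} {m : ℕ} (H : Set (X → Bool)) (L : Fin m → X × Bool) :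
    Set (X → Bool) :=
  {h ∈ H | empErr L h = 0}

/-- `h ∈ argmax_{h' ∈ H₀} χ̂(h', S)`. -/
def IsMostCompatible {X : Type*} {ml mu : ℕ} (H : Set (X → Bool)) (χ : (X → Bool) → X → ℝ)
    (L : Fin ml → X × Bool) (S : Fin mu → X) (h : X → Bool) : Prop :=
  h ∈ consistent H L ∧ ∀ h' ∈ consistent H L, empCompat χ S h' ≤ empCompat χ S h

/-- `H_{P,χ}(τ)`: the hypotheses in `H` of compatibility more than `1 - τ`. -/
def compatClass {X : Type*} [MeasurableSpace X] (P : Measure X) (H : Set (X → Bool))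
    (χ : (X → Bool) → X → ℝ) (τ : ℝ) : Set (X → Bool) :=
  {h ∈ H | 1 - τ < compat P χ h}

/-- The number of splits (distinct labelings) of the points `x` by hypotheses in `G`. -/
def splits {X : Type*} {n : ℕ} (G : Set (X → Bool)) (x : Fin n → X) : ℕ :=
  ((fun (h : X → Bool) (i : Fin n) => h (x i)) '' G).ncard

/-- `G[n, P]`: the expected number of splits of `n` independent points drawn from `P`. -/
def expSplits {X : Type*} [MeasurableSpace X] (P : Measure X) [IsProbabilityMeasure P]
    (G : Set (X → Bool)) (n : ℕ) : ℝ :=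
  ∫ x : Fin n → X, (splits G x : ℝ) ∂(Measure.pi fun _ => P)

/-- The usual measurability convention for a possibly uncountable hypothesis class: every `h ∈ H`
and every `χ(h, ·)` is measurable, and an event "some `h ∈ H` satisfies an open condition on its
values and compatibilities at `n` sample points, its error and its expected compatibility" has a
well-defined probability. -/
structure MeasurableClass {X : Type*} [MeasurableSpace X] (P : Measure X) [IsProbabilityMeasure P]
    (H : Set (X → Bool)) (χ : (X → Bool) → X → ℝ) (c : X → Bool) : Prop where
  hyp : ∀ h ∈ H, Measurable h
  comp : ∀ h ∈ H, Measurable (χ h)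
  event : ∀ (n : ℕ) (A : Set ((Fin n → Bool × ℝ) × ℝ × ℝ)), IsOpen A →
    NullMeasurableSet
      {x : Fin n → X | ∃ h ∈ H, (fun i => (h (x i), χ h (x i)), err P c h, compat P χ h) ∈ A}
      (Measure.pi fun _ => P)

end

end SSL

/-! Two failure events suffice. If all empirical compatibilities are within `ε / 4` of their
expectations, a consistent hypothesis whose empirical compatibility is maximal up to `ε / 4` loses
less than `3 * ε / 4 < 2 * ε` in true compatibility against the target, so it lies in `compatClass P
H χ (t + 2 * ε)`. If moreover no hypothesis of that class with error above `ε` fits the labeled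
sample, the selected one has error at most `ε`. The slack covers the case where no exact maximizer
exists; exact maximizers are covered too.

Both events are bounded by `mul_measure_le_lintegral_of_swap`: an exponential weight, maximized over
the class, is large in ghost expectation on the bad event, while its average over exchanges of
paired points is small. Consistency uses the weight 2 to the number of ghost errors (0 if there is
an error on the sample): its ghost mean is `(1 + err) ^ m`, and each labeling of the double sample
averages to at most 1, whence `measure_exists_consistent_le`.

For compatibilities, the weight is the exponential of `l` times the difference of the two sample
sums. Jensen's inequality bounds its ghost mean from below. Replacing each value by the indicator
that it exceeds a uniform random threshold only increases the mean of the exponential, so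
real-valued functions reduce to subgraph patterns. These are counted by Sauer–Shelah, and each has
exchange average at most `exp (m * l ^ 2 / 2)`; this gives `measure_exists_deviation_le`. -/

namespace SSL

/-! ### Symmetrization by exchanging paired points. -/

section Symmetrization

variable {m : ℕ} {ι X : Type*}

/-- The double sample consisting of `S` (slots `false`) and the ghost sample `S'` (slots `true`). -/
def glue (e : Fin m × Bool ≃ ι) (S S' : Fin m → X) (j : ι) : X :=
  if (e.symm j).2 then S' (e.symm j).1 else S (e.symm j).1

/-- Exchange the two members of the `i`-th pair whenever `σ i` is true. -/
def swapIdx (e : Fin m × Bool ≃ ι) (σ : Fin m → Bool) (j : ι) : ι :=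
  e ((e.symm j).1, xor (e.symm j).2 (σ (e.symm j).1))

theorem swapIdx_apply (e : Fin m × Bool ≃ ι) (σ : Fin m → Bool) (i : Fin m) (b : Bool) :
    swapIdx e σ (e (i, b)) = e (i, xor b (σ i)) := by
  simp [swapIdx]

theorem swapIdx_involutive (e : Fin m × Bool ≃ ι) (σ : Fin m → Bool) :
    Function.Involutive (swapIdx e σ) := by
  intro j
  simp [swapIdx]

variable [Fintype ι]

theorem prod_eq_prod_pairs {M : Type*} [CommMonoid M] (e : Fin m × Bool ≃ ι) (f : ι → M) :
    ∏ j, f j = ∏ i, (f (e (i, false)) * f (e (i, true))) := by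
  rw [← e.prod_comp, Fintype.prod_prod_type]
  exact Finset.prod_congr rfl fun i _ => by rw [Fintype.prod_bool, mul_comm]

variable [MeasurableSpace X]

theorem measurePreserving_glue (e : Fin m × Bool ≃ ι) (P : Measure X) [IsProbabilityMeasure P] :
    MeasurePreserving (fun p : (Fin m → X) × (Fin m → X) => glue e p.1 p.2)
      ((Measure.pi fun _ => P).prod (Measure.pi fun _ => P)) (Measure.pi fun _ => P) := by
  have hm : Measurable (fun p : (Fin m → X) × (Fin m → X) => glue e p.1 p.2) := by
    refine measurable_pi_lambda _ fun j => ?_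
    unfold glue
    split_ifs <;> fun_prop
  refine ⟨hm, (Measure.pi_eq fun s hs => ?_).symm⟩
  rw [Measure.map_apply hm (MeasurableSet.univ_pi hs)]
  have : (fun p : (Fin m → X) × (Fin m → X) => glue e p.1 p.2) ⁻¹' Set.univ.pi s =
      (Set.univ.pi fun i => s (e (i, false))) ×ˢ (Set.univ.pi fun i => s (e (i, true))) := by
    ext p
    simp only [Set.mem_preimage, Set.mem_univ_pi, Set.mem_prod]
    constructor
    · intro h
      exact ⟨fun i => by simpa [glue] using h (e (i, false)),
        fun i => by simpa [glue] using h (e (i, true))⟩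
    · rintro ⟨h0, h1⟩ j
      obtain ⟨⟨i, b⟩, rfl⟩ := e.surjective j
      cases b
      · simpa [glue] using h0 i
      · simpa [glue] using h1 i
  rw [this, Measure.prod_prod, Measure.pi_pi, Measure.pi_pi, prod_eq_prod_pairs e,
    Finset.prod_mul_distrib]

theorem measurePreserving_comp_swapIdx (e : Fin m × Bool ≃ ι) (P : Measure X)
    [IsProbabilityMeasure P] (σ : Fin m → Bool) :
    MeasurePreserving (fun z : ι → X => z ∘ swapIdx e σ)
      (Measure.pi fun _ => P) (Measure.pi fun _ => P) := by
  have hm : Measurable (fun z : ι → X => z ∘ swapIdx e σ) :=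
    measurable_pi_lambda _ fun j => measurable_pi_apply _
  refine ⟨hm, (Measure.pi_eq fun s hs => ?_).symm⟩
  rw [Measure.map_apply hm (MeasurableSet.univ_pi hs)]
  have : (fun z : ι → X => z ∘ swapIdx e σ) ⁻¹' Set.univ.pi s =
      Set.univ.pi fun j => s (swapIdx e σ j) := by
    ext z
    simp only [Set.mem_preimage, Set.mem_univ_pi, Function.comp]
    constructor
    · intro h j
      simpa [swapIdx_involutive e σ j] using h (swapIdx e σ j)
    · intro h j
      simpa [swapIdx_involutive e σ j] using h (swapIdx e σ j)
  rw [this, Measure.pi_pi]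
  exact Equiv.prod_comp (swapIdx_involutive e σ).toPerm fun j => P (s j)

/-- This direction is superadditivity of the lower integral, so the summands need not be measurable.
-/
theorem sum_lintegral_le {α κ : Type*} [MeasurableSpace α] (μ : Measure α) (s : Finset κ)
    (f : κ → α → ENNReal) : ∑ k ∈ s, ∫⁻ a, f k a ∂μ ≤ ∫⁻ a, ∑ k ∈ s, f k a ∂μ := by
  classical
  induction s using Finset.induction_on with
  | empty => simp
  | insert k s hk ih =>
    simp only [Finset.sum_insert hk]
    exact (add_le_add_right ih _).trans (le_lintegral_add _ _)

/-- Symmetrization with a ghost sample: if the weight `F` of the double sample has ghost-expectation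
at least `K` whenever the first sample lies in `B`, then `P(B)` is controlled by the average of `F`
over the exchanges of the pairs. -/
theorem mul_measure_le_lintegral_of_swap (e : Fin m × Bool ≃ ι) (P : Measure X)
    [IsProbabilityMeasure P] (F : (ι → X) → ENNReal)
    (hF : AEMeasurable F (Measure.pi fun _ => P)) (B : Set (Fin m → X)) (K : ENNReal)
    (hB : ∀ S ∈ B, K ≤ ∫⁻ S', F (glue e S S') ∂(Measure.pi fun _ => P))
    (N : (ι → X) → ENNReal)
    (hN : ∀ z, ∑ σ : Fin m → Bool, F (z ∘ swapIdx e σ) ≤ 2 ^ m * N z) :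
    K * (Measure.pi fun _ : Fin m => P) B ≤ ∫⁻ z, N z ∂(Measure.pi fun _ => P) := by
  have hg := measurePreserving_glue e P
  have hFg : AEMeasurable (fun p : (Fin m → X) × (Fin m → X) => F (glue e p.1 p.2))
      ((Measure.pi fun _ => P).prod (Measure.pi fun _ => P)) :=
    hF.comp_quasiMeasurePreserving hg.quasiMeasurePreserving
  -- `B` need not be measurable: it is enclosed in a superlevel set of the ghost integral, to which
  -- Markov's inequality applies.
  have h1 : K * (Measure.pi fun _ : Fin m => P) B ≤ ∫⁻ z, F z ∂(Measure.pi fun _ => P) := by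
    calc K * (Measure.pi fun _ : Fin m => P) B
        ≤ K * (Measure.pi fun _ : Fin m => P)
            {S | K ≤ ∫⁻ S', F (glue e S S') ∂(Measure.pi fun _ => P)} := by
          gcongr
          exact hB
      _ ≤ ∫⁻ S, ∫⁻ S', F (glue e S S') ∂(Measure.pi fun _ => P) ∂(Measure.pi fun _ => P) :=
          mul_meas_ge_le_lintegral₀ hFg.lintegral_prod_right' K
      _ = ∫⁻ z, F z ∂(Measure.pi fun _ => P) := by
          rw [← lintegral_prod _ hFg, ← hg.map_eq, lintegral_map' (hg.map_eq ▸ hF)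
            hg.measurable.aemeasurable]
  have h2 : ∀ σ : Fin m → Bool, ∫⁻ z, F (z ∘ swapIdx e σ) ∂(Measure.pi fun _ => P) =
      ∫⁻ z, F z ∂(Measure.pi fun _ => P) := fun σ => by
    have hs := measurePreserving_comp_swapIdx e P σ
    conv_rhs => rw [← hs.map_eq]
    rw [lintegral_map' (hs.map_eq.symm ▸ hF) hs.measurable.aemeasurable]
  have h3 : 2 ^ m * ∫⁻ z, F z ∂(Measure.pi fun _ => P) ≤
      2 ^ m * ∫⁻ z, N z ∂(Measure.pi fun _ : ι => P) := by
    calc 2 ^ m * ∫⁻ z, F z ∂(Measure.pi fun _ => P)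
        = ∑ σ : Fin m → Bool, ∫⁻ z, F (z ∘ swapIdx e σ) ∂(Measure.pi fun _ => P) := by
          simp [h2]
      _ ≤ ∫⁻ z, ∑ σ : Fin m → Bool, F (z ∘ swapIdx e σ) ∂(Measure.pi fun _ => P) :=
          sum_lintegral_le _ _ _
      _ ≤ ∫⁻ z, 2 ^ m * N z ∂(Measure.pi fun _ => P) := lintegral_mono hN
      _ = _ := lintegral_const_mul' _ _ (by simp)
  exact h1.trans ((ENNReal.mul_le_mul_iff_right (by simp) (by simp)).1 h3)

/-- Sums over all exchanges of products over pairs factorize. -/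
theorem sum_swap_prod (e : Fin m × Bool ≃ ι) (f : ι → ι → ENNReal) :
    ∑ σ : Fin m → Bool, ∏ j, f (swapIdx e σ j) j =
      ∏ i, (f (e (i, false)) (e (i, false)) * f (e (i, true)) (e (i, true)) +
        f (e (i, true)) (e (i, false)) * f (e (i, false)) (e (i, true))) := by
  have h := Finset.prod_univ_sum (fun _ : Fin m => (Finset.univ : Finset Bool))
    (fun i s => f (e (i, xor false s)) (e (i, false)) * f (e (i, xor true s)) (e (i, true)))
  rw [Fintype.piFinset_univ] at h
  calc ∑ σ : Fin m → Bool, ∏ j, f (swapIdx e σ j) j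
      = ∑ σ : Fin m → Bool, ∏ i, f (e (i, xor false (σ i))) (e (i, false)) *
          f (e (i, xor true (σ i))) (e (i, true)) :=
        Finset.sum_congr rfl fun σ _ => by
          rw [prod_eq_prod_pairs e]
          simp only [swapIdx_apply]
    _ = _ := by
      rw [← h]
      refine Finset.prod_congr rfl fun i _ => ?_
      simp [add_comm]

end Symmetrization

theorem lintegral_pi_prod {ι : Type*} [Fintype ι] {E : ι → Type*} [∀ i, MeasurableSpace (E i)]
    (μ : ∀ i, Measure (E i)) [∀ i, SigmaFinite (μ i)] (f : ∀ i, E i → ℝ)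
    (hf : ∀ i, Integrable (f i) (μ i)) (h0 : ∀ i x, 0 ≤ f i x) :
    ∫⁻ x, ∏ i, ENNReal.ofReal (f i (x i)) ∂(Measure.pi μ) =
      ∏ i, ∫⁻ x, ENNReal.ofReal (f i x) ∂(μ i) := by
  have h1 : ∀ x : ∀ i, E i, ∏ i, ENNReal.ofReal (f i (x i)) = ENNReal.ofReal (∏ i, f i (x i)) :=
    fun x => (ENNReal.ofReal_prod_of_nonneg fun i _ => h0 i _).symm
  simp_rw [h1]
  rw [← ofReal_integral_eq_lintegral_ofReal (Integrable.fintype_prod_dep hf)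
    (Filter.Eventually.of_forall fun x => Finset.prod_nonneg fun i _ => h0 i _),
    integral_fintype_prod_eq_prod, ENNReal.ofReal_prod_of_nonneg
      fun i _ => integral_nonneg (h0 i)]
  exact Finset.prod_congr rfl fun i _ => ofReal_integral_eq_lintegral_ofReal (hf i)
    (Filter.Eventually.of_forall (h0 i))

/-! ### Sauer–Shelah for subgraphs. -/

section Growth

theorem card_le_of_shatters {X : Type*} {F : Set (X → ℝ)} {d : ℕ} (hd : VCdim F = d)
    {s : Finset X} (hs : Shatters F s) : s.card ≤ d := by
  have : (s.card : ℕ∞) ≤ VCdim F := le_iSup₂_of_le s hs le_rfl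
  rw [hd] at this
  exact_mod_cast this

open Classical in
/-- The sets of indices `j` at which some member of `F` exceeds the threshold `r j` at `z j`. -/
noncomputable def thresholdPatterns {X ι : Type*} [Fintype ι] (F : Set (X → ℝ)) (z : ι → X)
    (r : ι → ℝ) : Finset (Finset ι) :=
  {w | ∃ f ∈ F, ∀ j, j ∈ w ↔ r j < f (z j)}

theorem card_le_of_shatters_thresholdPatterns {X ι : Type*} [Fintype ι] [DecidableEq ι]
    {F : Set (X → ℝ)} {d : ℕ} (hd : VCdim F = d) (z : ι → X) (r : ι → ℝ) {J : Finset ι}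
    (hJ : (thresholdPatterns F z r).Shatters J) : J.card ≤ d := by
  classical
  have key : ∀ t ⊆ J, ∃ f ∈ F, ∀ j ∈ J, j ∈ t ↔ r j < f (z j) := by
    intro t ht
    obtain ⟨u, hu, hut⟩ := hJ ht
    simp only [thresholdPatterns, Finset.mem_filter, Finset.mem_univ, true_and] at hu
    obtain ⟨f, hf, hfu⟩ := hu
    refine ⟨f, hf, fun j hj => ?_⟩
    rw [← hfu, ← hut, Finset.mem_inter]
    simp [hj]
  -- Shattered indices carry distinct points: at a common point, cutting out `{k}` forces `r k < r
  -- j`, and by symmetry the reverse. Hence the thresholds descend from indices to points.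
  have hlt : ∀ j ∈ J, ∀ k ∈ J, z j = z k → j ≠ k → r k < r j := by
    intro j hj k hk hjk hne
    obtain ⟨f, -, hf⟩ := key {k} (by simpa using hk)
    have h1 := (hf k hk).1 (by simp)
    have h2 := mt (hf j hj).2 (by simpa using hne)
    rw [hjk] at h2
    linarith
  have hinj : Set.InjOn z J := by
    intro j hj k hk hjk
    by_contra hne
    exact lt_asymm (hlt j hj k hk hjk hne) (hlt k hk j hj hjk.symm (Ne.symm hne))
  rw [← Finset.card_image_of_injOn hinj]
  apply card_le_of_shatters hd
  have hr : ∀ x : X, ∃ a : ℝ, ∀ j ∈ J, z j = x → a = r j := by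
    intro x
    by_cases hx : ∃ j ∈ J, z j = x
    · obtain ⟨j, hj, rfl⟩ := hx
      exact ⟨r j, fun k hk h => by rw [hinj hk hj h]⟩
    · exact ⟨0, fun j hj h => absurd ⟨j, hj, h⟩ hx⟩
  choose ρ hρ using hr
  refine ⟨ρ, fun b _ => ?_⟩
  obtain ⟨f, hf, hfb⟩ := key {j ∈ J | z j ∈ b} (Finset.filter_subset _ _)
  refine ⟨f, hf, fun x hx => ?_⟩
  obtain ⟨j, hj, rfl⟩ := Finset.mem_image.1 hx
  rw [hρ (z j) j hj rfl, ← hfb j hj, Finset.mem_filter]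
  simp [hj]

/-- Weighting by powers of `y` compares the sum with `(1 + y) ^ n / y ^ d`. Keeping `y` free allows
a choice of order `ε ^ 2`, which yields `log (1 / ε)` rather than the logarithm of the sample size.
-/
theorem sum_choose_le_exp (n d : ℕ) {y : ℝ} (hy : 0 < y) (hy1 : y ≤ 1) :
    ((∑ k ∈ Finset.Iic d, n.choose k : ℕ) : ℝ) ≤ Real.exp (n * y + d * Real.log (1 / y)) := by
  have h1 : ∑ k ∈ Finset.Iic d, (n.choose k : ℝ) * y ^ d ≤ (1 + y) ^ n := by
    calc ∑ k ∈ Finset.Iic d, (n.choose k : ℝ) * y ^ d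
        ≤ ∑ k ∈ Finset.Iic d, (n.choose k : ℝ) * y ^ k := by
          refine Finset.sum_le_sum fun k hk => ?_
          exact mul_le_mul_of_nonneg_left
            (pow_le_pow_of_le_one hy.le hy1 (Finset.mem_Iic.1 hk)) (by positivity)
      _ ≤ ∑ k ∈ Finset.Iic (max d n), (n.choose k : ℝ) * y ^ k := by
          refine Finset.sum_le_sum_of_subset_of_nonneg ?_ fun _ _ _ => by positivity
          exact Finset.Iic_subset_Iic.2 (le_max_left _ _)
      _ = ∑ k ∈ Finset.range (n + 1), (n.choose k : ℝ) * y ^ k := by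
          symm
          refine Finset.sum_subset (fun k hk => ?_) fun k _ hk => ?_
          · simp only [Finset.mem_range, Finset.mem_Iic] at *
            omega
          · rw [Nat.choose_eq_zero_of_lt (by simpa using hk)]
            simp
      _ = (1 + y) ^ n := by
          rw [add_comm 1 y, add_pow]
          exact Finset.sum_congr rfl fun k _ => by rw [one_pow]; ring
  rw [← Finset.sum_mul] at h1
  have h2 : (1 + y) ^ n ≤ Real.exp (n * y) := by
    rw [Real.exp_nat_mul]
    exact pow_le_pow_left₀ (by positivity) (by linarith [Real.add_one_le_exp y]) n
  have h3 : Real.exp (d * Real.log (1 / y)) = (y ^ d)⁻¹ := by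
    rw [Real.exp_nat_mul, Real.exp_log (by positivity), one_div, inv_pow]
  rw [Real.exp_add, h3, ← div_eq_mul_inv, le_div_iff₀ (by positivity)]
  push_cast
  exact h1.trans h2

theorem card_thresholdPatterns_le {X ι : Type*} [Fintype ι] {F : Set (X → ℝ)} {d : ℕ}
    (hd : VCdim F = d) (z : ι → X) (r : ι → ℝ) {y : ℝ} (hy : 0 < y) (hy1 : y ≤ 1) :
    ((thresholdPatterns F z r).card : ℝ) ≤
      Real.exp (Fintype.card ι * y + d * Real.log (1 / y)) := by
  classical
  refine le_trans ?_ (sum_choose_le_exp (Fintype.card ι) d hy hy1)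
  -- Pajor's form: a set family has at most as many members as it shatters sets.
  have h1 := (thresholdPatterns F z r).card_le_card_shatterer
  have h2 := Finset.card_shatterer_le_sum_vcDim (𝒜 := thresholdPatterns F z r)
  have h3 : (thresholdPatterns F z r).vcDim ≤ d := Finset.sup_le fun J hJ =>
    card_le_of_shatters_thresholdPatterns hd z r (Finset.mem_shatterer.1 hJ)
  exact_mod_cast (h1.trans h2).trans (Finset.sum_le_sum_of_subset (Finset.Iic_subset_Iic.2 h3))

end Growth

/-- Suprema over the class have superlevel sets of the form "some `h` satisfies an open condition",
which is what `MeasurableClass.event` controls. -/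
theorem aemeasurable_of_nullMeasurableSet_lt {α : Type*} [MeasurableSpace α] {μ : Measure α}
    {F : α → ENNReal} (h : ∀ a, NullMeasurableSet {z | a < F z} μ) : AEMeasurable F μ :=
  NullMeasurable.aemeasurable (measurable_of_Ioi (δ := NullMeasurableSpace α μ) h)

/-! ### Uniform convergence of empirical compatibilities. -/

section UniformDeviation

/-- Jensen's inequality for a random threshold: `v` is the mean of `1[r < v]` for `r` uniform. -/
theorem ofReal_exp_mul_le_lintegral_threshold (a : ℝ) {v : ℝ} (hv : v ∈ Set.Icc (0 : ℝ) 1) :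
    ENNReal.ofReal (Real.exp (a * v)) ≤
      ∫⁻ r, ENNReal.ofReal (Real.exp (a * if r < v then 1 else 0))
        ∂(volume.restrict (Set.Ico (0 : ℝ) 1)) := by
  have h1 : ∀ r : ℝ, ENNReal.ofReal (Real.exp (a * if r < v then 1 else 0)) =
      (Set.Iio v).indicator (fun _ => ENNReal.ofReal (Real.exp a)) r +
        (Set.Ici v).indicator (fun _ => 1) r := by
    intro r
    by_cases hr : r < v
    · simp [hr]
    · simp [hr, not_lt.1 hr]
  simp_rw [h1]
  rw [lintegral_add_left (measurable_const.indicator measurableSet_Iio),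
    lintegral_indicator_const measurableSet_Iio, lintegral_indicator_const measurableSet_Ici,
    Measure.restrict_apply measurableSet_Iio, Measure.restrict_apply measurableSet_Ici]
  have e1 : Set.Iio v ∩ Set.Ico (0 : ℝ) 1 = Set.Ico 0 v := by
    ext r
    simp only [Set.mem_inter_iff, Set.mem_Iio, Set.mem_Ico]
    exact ⟨fun h => ⟨h.2.1, h.1⟩, fun h => ⟨h.2, h.1, h.2.trans_le hv.2⟩⟩
  have e2 : Set.Ici v ∩ Set.Ico (0 : ℝ) 1 = Set.Ico v 1 := by
    ext r
    simp only [Set.mem_inter_iff, Set.mem_Ici, Set.mem_Ico]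
    exact ⟨fun h => ⟨h.1, h.2.2⟩, fun h => ⟨h.1, hv.1.trans h.1, h.2⟩⟩
  rw [e1, e2, Real.volume_Ico, Real.volume_Ico, sub_zero, one_mul,
    ← ENNReal.ofReal_mul (Real.exp_pos a).le,
    ← ENNReal.ofReal_add (mul_nonneg (Real.exp_pos a).le hv.1) (by linarith [hv.2])]
  apply ENNReal.ofReal_le_ofReal
  -- Convexity between `0` and `a`: `exp (a * v) ≤ v * exp a + (1 - v)`.
  have h := convexOn_exp.2 (Set.mem_univ a) (Set.mem_univ 0) hv.1
    (by linarith [hv.2] : (0 : ℝ) ≤ 1 - v) (by ring)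
  simp only [smul_eq_mul, mul_zero, add_zero, Real.exp_zero, mul_one] at h
  rw [mul_comm a v, mul_comm (Real.exp a) v]
  exact h

theorem prod_ofReal_exp_le_lintegral_threshold {ι : Type*} [Fintype ι] (a v : ι → ℝ)
    (hv : ∀ j, v j ∈ Set.Icc (0 : ℝ) 1) :
    ∏ j, ENNReal.ofReal (Real.exp (a j * v j)) ≤
      ∫⁻ r : ι → ℝ, ∏ j, ENNReal.ofReal (Real.exp (a j * if r j < v j then 1 else 0))
        ∂(Measure.pi fun _ => volume.restrict (Set.Ico (0 : ℝ) 1)) := by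
  have : IsFiniteMeasure (volume.restrict (Set.Ico (0 : ℝ) 1)) := ⟨by simp⟩
  rw [lintegral_pi_prod (fun _ : ι => volume.restrict (Set.Ico (0 : ℝ) 1))
    (fun j r => Real.exp (a j * if r < v j then 1 else 0)) (fun j => ?_)
    fun _ _ => (Real.exp_pos _).le]
  · exact Finset.prod_le_prod' fun j _ => ofReal_exp_mul_le_lintegral_threshold (a j) (hv j)
  · refine Integrable.of_bound (C := Real.exp |a j|) ?_ (Filter.Eventually.of_forall fun r => ?_)
    · exact (Real.measurable_exp.comp ((Measurable.ite measurableSet_Iio measurable_const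
        measurable_const).const_mul _)).aestronglyMeasurable
    · rw [Real.norm_eq_abs, Real.abs_exp]
      apply Real.exp_le_exp.2
      split_ifs
      · simpa using le_abs_self (a j)
      · simp

/-- The weight `exp (λ ∑ᵢ (f (xᵢ) - f (x'ᵢ)))`, maximized over `f ∈ F`, as a product over the
slots of the double sample. -/
noncomputable def deviationWeight {m : ℕ} {ι X : Type*} [Fintype ι] (e : Fin m × Bool ≃ ι)
    (F : Set (X → ℝ)) (l : ℝ) (z : ι → X) : ENNReal :=
  ⨆ f ∈ F, ∏ j, ENNReal.ofReal (Real.exp ((if (e.symm j).2 then -l else l) * f (z j)))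

/-- When exactly one of `p`, `q` holds the sum is `2 * cosh l`; otherwise it is 2. -/
theorem exp_pair_le (l : ℝ) (p q : Prop) [Decidable p] [Decidable q] :
    ENNReal.ofReal (Real.exp (l * if p then 1 else 0)) *
        ENNReal.ofReal (Real.exp (-l * if q then 1 else 0)) +
      ENNReal.ofReal (Real.exp (-l * if p then 1 else 0)) *
        ENNReal.ofReal (Real.exp (l * if q then 1 else 0)) ≤
      2 * ENNReal.ofReal (Real.exp (l ^ 2 / 2)) := by
  have h2 : (2 : ENNReal) = ENNReal.ofReal 2 := by simp
  rw [h2, ← ENNReal.ofReal_mul (Real.exp_pos _).le, ← ENNReal.ofReal_mul (Real.exp_pos _).le,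
    ← ENNReal.ofReal_mul zero_le_two, ← ENNReal.ofReal_add (by positivity) (by positivity),
    ← Real.exp_add, ← Real.exp_add]
  apply ENNReal.ofReal_le_ofReal
  have h := Real.cosh_le_exp_half_sq l
  rw [Real.cosh_eq] at h
  have h1 : 1 ≤ Real.exp (l ^ 2 / 2) := Real.one_le_exp (by positivity)
  by_cases hp : p <;> by_cases hq : q <;> simp [hp, hq] <;> linarith

theorem sum_deviationWeight_le {m : ℕ} {ι X : Type*} [Fintype ι] (e : Fin m × Bool ≃ ι)
    {F : Set (X → ℝ)} (hF : ∀ f ∈ F, ∀ x, f x ∈ Set.Icc (0 : ℝ) 1) {d : ℕ} (hd : VCdim F = d)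
    (l : ℝ) {y : ℝ} (hy : 0 < y) (hy1 : y ≤ 1) (z : ι → X) :
    ∑ σ : Fin m → Bool, deviationWeight e F l (z ∘ swapIdx e σ) ≤
      2 ^ m * ENNReal.ofReal (Real.exp (2 * m * y + d * Real.log (1 / y) + m * l ^ 2 / 2)) := by
  classical
  set s : ι → ℝ := fun j => if (e.symm j).2 then -l else l with hs
  set U : Measure (ι → ℝ) := Measure.pi fun _ => volume.restrict (Set.Ico (0 : ℝ) 1) with hU
  have hcard : Fintype.card ι = m * 2 := by
    rw [← Fintype.card_congr e]
    simp
  have hUuniv : U Set.univ = 1 := by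
    simp [hU, Measure.pi_univ]
  have step : ∀ σ : Fin m → Bool, deviationWeight e F l (z ∘ swapIdx e σ) ≤
      ∫⁻ r, ∑ w ∈ thresholdPatterns F z r,
        ∏ j, ENNReal.ofReal (Real.exp (s (swapIdx e σ j) * if j ∈ w then 1 else 0)) ∂U := by
    intro σ
    refine iSup₂_le fun f hf => ?_
    -- The exchange is moved from the points to the signs, so that the patterns depend on `z` and
    -- `r` but not on `σ`, and the two sums can be interchanged.
    have h1 : ∏ j, ENNReal.ofReal (Real.exp (s j * f (z (swapIdx e σ j)))) =
        ∏ j, ENNReal.ofReal (Real.exp (s (swapIdx e σ j) * f (z j))) := by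
      rw [← Equiv.prod_comp (swapIdx_involutive e σ).toPerm]
      refine Finset.prod_congr rfl fun j _ => ?_
      simp only [Function.Involutive.coe_toPerm, swapIdx_involutive e σ j]
    change ∏ j, ENNReal.ofReal (Real.exp (s j * f (z (swapIdx e σ j)))) ≤ _
    rw [h1]
    refine (prod_ofReal_exp_le_lintegral_threshold (fun j => s (swapIdx e σ j))
      (fun j => f (z j)) fun j => hF f hf _).trans (lintegral_mono fun r => ?_)
    have hw : ({j | r j < f (z j)} : Finset ι) ∈ thresholdPatterns F z r := by
      simp only [thresholdPatterns, Finset.mem_filter, Finset.mem_univ, true_and]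
      exact ⟨f, hf, fun j => Iff.rfl⟩
    refine le_trans (le_of_eq ?_) (Finset.single_le_sum (f := fun w : Finset ι =>
      ∏ j, ENNReal.ofReal (Real.exp (s (swapIdx e σ j) * if j ∈ w then 1 else 0)))
      (fun _ _ => zero_le) hw)
    simp
  have pairs : ∀ w : Finset ι, ∑ σ : Fin m → Bool,
      ∏ j, ENNReal.ofReal (Real.exp (s (swapIdx e σ j) * if j ∈ w then 1 else 0)) ≤
      (2 * ENNReal.ofReal (Real.exp (l ^ 2 / 2))) ^ m := by
    intro w
    rw [sum_swap_prod e fun j' j => ENNReal.ofReal (Real.exp (s j' * if j ∈ w then 1 else 0))]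
    refine (Finset.prod_le_prod' (g := fun _ => 2 * ENNReal.ofReal (Real.exp (l ^ 2 / 2)))
      fun i _ => ?_).trans_eq (by simp)
    simpa [hs] using exp_pair_le l (e (i, false) ∈ w) (e (i, true) ∈ w)
  calc ∑ σ : Fin m → Bool, deviationWeight e F l (z ∘ swapIdx e σ)
      ≤ ∫⁻ r, ∑ σ : Fin m → Bool, ∑ w ∈ thresholdPatterns F z r,
        ∏ j, ENNReal.ofReal (Real.exp (s (swapIdx e σ j) * if j ∈ w then 1 else 0)) ∂U :=
        (Finset.sum_le_sum fun σ _ => step σ).trans (sum_lintegral_le _ _ _)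
    _ ≤ ∫⁻ _, ENNReal.ofReal (Real.exp (2 * m * y + d * Real.log (1 / y))) *
          (2 * ENNReal.ofReal (Real.exp (l ^ 2 / 2))) ^ m ∂U := by
        refine lintegral_mono fun r => ?_
        rw [Finset.sum_comm]
        refine (Finset.sum_le_sum fun w _ => pairs w).trans ?_
        rw [Finset.sum_const, nsmul_eq_mul]
        gcongr
        rw [← ENNReal.ofReal_natCast]
        apply ENNReal.ofReal_le_ofReal
        have := card_thresholdPatterns_le hd z r hy hy1
        rw [hcard] at this
        push_cast at this
        rwa [mul_comm (m : ℝ) 2] at this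
    _ = _ := by
        rw [lintegral_const, hUuniv, mul_one, mul_pow, ← ENNReal.ofReal_pow (Real.exp_pos _).le,
          ← Real.exp_nat_mul, mul_left_comm, ← ENNReal.ofReal_mul (Real.exp_pos _).le,
          ← Real.exp_add, mul_div_assoc]

variable {X : Type*} [MeasurableSpace X] {P : Measure X} [IsProbabilityMeasure P]
  {H : Set (X → Bool)} {χ : (X → Bool) → X → ℝ} {c : X → Bool}

theorem MeasurableClass.aemeasurable_deviationWeight (hM : MeasurableClass P H χ c) {m n : ℕ}
    (e : Fin m × Bool ≃ Fin n) (l : ℝ) :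
    AEMeasurable (deviationWeight e (χ '' H) l) (Measure.pi fun _ => P) := by
  refine aemeasurable_of_nullMeasurableSet_lt fun a => ?_
  let φ : (Fin n → Bool × ℝ) × ℝ × ℝ → ENNReal := fun p =>
    ENNReal.ofReal (∏ j, Real.exp ((if (e.symm j).2 then -l else l) * (p.1 j).2))
  have hφ : Continuous φ := by
    refine ENNReal.continuous_ofReal.comp ?_
    fun_prop
  convert hM.event n {p | a < φ p} (isOpen_lt continuous_const hφ) using 1
  ext z
  simp only [deviationWeight, Set.mem_ofPred_eq, lt_iSup_iff, φ,
    ENNReal.ofReal_prod_of_nonneg fun _ _ => (Real.exp_pos _).le]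
  simp

/-- A single `h` bounds the supremum from below; independence factors its ghost integral, and
Jensen's inequality is applied to each factor. -/
theorem le_lintegral_deviationWeight (hM : MeasurableClass P H χ c)
    (hχ : ∀ h ∈ H, ∀ x, χ h x ∈ Set.Icc (0 : ℝ) 1) {m n : ℕ} (e : Fin m × Bool ≃ Fin n) (l : ℝ)
    {h : X → Bool} (hh : h ∈ H) (S : Fin m → X) :
    ENNReal.ofReal (Real.exp (l * (∑ i, χ h (S i) - m * compat P χ h))) ≤
      ∫⁻ S', deviationWeight e (χ '' H) l (glue e S S') ∂(Measure.pi fun _ => P) := by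
  have hint : Integrable (χ h) P := Integrable.of_bound (C := 1)
    (hM.comp h hh).aestronglyMeasurable (Filter.Eventually.of_forall fun x => by
      rw [Real.norm_eq_abs, abs_le]
      exact ⟨by linarith [(hχ h hh x).1], (hχ h hh x).2⟩)
  have hintexp : Integrable (fun x => Real.exp (-l * χ h x)) P :=
    Integrable.of_bound (C := Real.exp |l|)
      (Real.measurable_exp.comp ((hM.comp h hh).const_mul _)).aestronglyMeasurable
      (Filter.Eventually.of_forall fun x => by
        rw [Real.norm_eq_abs, Real.abs_exp]
        apply Real.exp_le_exp.2
        calc -l * χ h x ≤ |-l * χ h x| := le_abs_self _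
          _ = |l| * χ h x := by rw [abs_mul, abs_neg, abs_of_nonneg (hχ h hh x).1]
          _ ≤ |l| := mul_le_of_le_one_right (abs_nonneg l) (hχ h hh x).2)
  have jensen : Real.exp (-l * compat P χ h) ≤ ∫ x, Real.exp (-l * χ h x) ∂P := by
    rw [compat, ← integral_const_mul]
    exact convexOn_exp.map_integral_le Real.continuous_exp.continuousOn isClosed_univ
      (Filter.Eventually.of_forall fun _ => Set.mem_univ _) (hint.const_mul _) hintexp
  have hprod : ∀ S' : Fin m → X,
      ENNReal.ofReal (Real.exp (l * ∑ i, χ h (S i))) *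
        ∏ i, ENNReal.ofReal (Real.exp (-l * χ h (S' i))) ≤
      deviationWeight e (χ '' H) l (glue e S S') := by
    intro S'
    refine le_trans (le_of_eq ?_) (le_iSup₂_of_le (χ h) (Set.mem_image_of_mem χ hh) le_rfl)
    rw [prod_eq_prod_pairs e, Finset.prod_mul_distrib]
    congr 1
    · rw [Finset.mul_sum, Real.exp_sum,
        ENNReal.ofReal_prod_of_nonneg fun _ _ => (Real.exp_pos _).le]
      simp [glue]
    · simp [glue]
  refine le_trans ?_ (lintegral_mono hprod)
  rw [lintegral_const_mul' _ _ ENNReal.ofReal_ne_top,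
    lintegral_pi_prod (fun _ : Fin m => P) (fun _ x => Real.exp (-l * χ h x)) (fun _ => hintexp)
      fun _ _ => (Real.exp_pos _).le, Finset.prod_const, Finset.card_univ, Fintype.card_fin,
    ← ofReal_integral_eq_lintegral_ofReal hintexp
      (Filter.Eventually.of_forall fun _ => (Real.exp_pos _).le),
    ← ENNReal.ofReal_pow (integral_nonneg fun _ => (Real.exp_pos _).le),
    ← ENNReal.ofReal_mul (Real.exp_pos _).le]
  apply ENNReal.ofReal_le_ofReal
  calc Real.exp (l * (∑ i, χ h (S i) - m * compat P χ h))
      = Real.exp (l * ∑ i, χ h (S i)) * Real.exp (-l * compat P χ h) ^ m := by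
        rw [← Real.exp_nat_mul, ← Real.exp_add]
        ring_nf
    _ ≤ _ := by gcongr

/-- Uniform deviation bound for a class of finite pseudo-dimension; the sign of `l` selects the
side of the deviation, and `y` is a free parameter. -/
theorem measure_exists_deviation_le (hM : MeasurableClass P H χ c)
    (hχ : ∀ h ∈ H, ∀ x, χ h x ∈ Set.Icc (0 : ℝ) 1) {d : ℕ} (hd : VCdim (χ '' H) = d)
    (m : ℕ) (l a : ℝ) {y : ℝ} (hy : 0 < y) (hy1 : y ≤ 1) :
    (Measure.pi fun _ : Fin m => P)
        {S | ∃ h ∈ H, a ≤ l * (∑ i, χ h (S i) - m * compat P χ h)} ≤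
      ENNReal.ofReal
        (Real.exp (2 * m * y + d * Real.log (1 / y) + m * l ^ 2 / 2 - a)) := by
  have e : Fin m × Bool ≃ Fin (2 * m) := Fintype.equivFinOfCardEq (by simp [mul_comm])
  have key := mul_measure_le_lintegral_of_swap e P (deviationWeight e (χ '' H) l)
    (hM.aemeasurable_deviationWeight e l)
    {S | ∃ h ∈ H, a ≤ l * (∑ i, χ h (S i) - m * compat P χ h)}
    (ENNReal.ofReal (Real.exp a))
    (by
      rintro S ⟨h, hh, ha⟩
      exact (ENNReal.ofReal_le_ofReal (Real.exp_le_exp.2 ha)).trans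
        (le_lintegral_deviationWeight hM hχ e l hh S))
    (fun _ => ENNReal.ofReal (Real.exp (2 * m * y + d * Real.log (1 / y) + m * l ^ 2 / 2)))
    (fun z => sum_deviationWeight_le e
      (by rintro _ ⟨h, hh, rfl⟩ x; exact hχ h hh x) hd l hy hy1 z)
  rw [lintegral_const, measure_univ, mul_one, mul_comm] at key
  rw [Real.exp_sub, ENNReal.ofReal_div_of_pos (Real.exp_pos a)]
  rwa [ENNReal.le_div_iff_mul_le (Or.inl (by simp [Real.exp_pos])) (Or.inl ENNReal.ofReal_ne_top)]

end UniformDeviation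

/-! ### Consistent hypotheses of large error. -/

section Consistency

/-- The weight `1[f = c on S] * 2 ^ #{errors of f on S'}` of a double sample, maximized over
`f ∈ G`, as a product over the slots. -/
noncomputable def errorWeight {m : ℕ} {ι X : Type*} [Fintype ι] (e : Fin m × Bool ≃ ι)
    (G : Set (X → Bool)) (c : X → Bool) (z : ι → X) : ENNReal :=
  ⨆ h ∈ G, ∏ j, if h (z j) = c (z j) then 1 else if (e.symm j).2 then 2 else 0

theorem sum_errorWeight_le {m n : ℕ} {X : Type*} (e : Fin m × Bool ≃ Fin n)
    (G : Set (X → Bool)) (c : X → Bool) (z : Fin n → X) :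
    ∑ σ : Fin m → Bool, errorWeight e G c (z ∘ swapIdx e σ) ≤ 2 ^ m * (splits G z : ENNReal) := by
  have hfin : ((fun (h : X → Bool) (j : Fin n) => h (z j)) '' G).Finite := Set.toFinite _
  let ψ : (Fin n → Bool) → Fin n → Fin n → ENNReal := fun w j' j =>
    if w j = c (z j) then 1 else if (e.symm j').2 then 2 else 0
  have step : ∀ σ : Fin m → Bool, errorWeight e G c (z ∘ swapIdx e σ) ≤
      ∑ w ∈ hfin.toFinset, ∏ j, ψ w (swapIdx e σ j) j := by
    intro σ
    refine iSup₂_le fun h hh => ?_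
    have hw : (fun j => h (z j)) ∈ hfin.toFinset := by
      rw [Set.Finite.mem_toFinset]
      exact ⟨h, hh, rfl⟩
    refine le_trans (le_of_eq ?_) (Finset.single_le_sum (f := fun w : Fin n → Bool =>
      ∏ j, ψ w (swapIdx e σ j) j) (fun _ _ => zero_le) hw)
    rw [← Equiv.prod_comp (swapIdx_involutive e σ).toPerm]
    refine Finset.prod_congr rfl fun j _ => ?_
    rw [Function.Involutive.coe_toPerm, Function.comp, swapIdx_involutive e σ j]
  -- A pair with no error contributes `1 + 1`, with one error `2 + 0`, and with two errors `0`: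
  -- always at most 2.
  have pairs : ∀ w : Fin n → Bool,
      ∑ σ : Fin m → Bool, ∏ j, ψ w (swapIdx e σ j) j ≤ 2 ^ m := by
    intro w
    rw [sum_swap_prod e (ψ w)]
    refine (Finset.prod_le_prod' (g := fun _ => (2 : ENNReal)) fun i _ => ?_).trans_eq (by simp)
    by_cases h0 : w (e (i, false)) = c (z (e (i, false))) <;>
      by_cases h1 : w (e (i, true)) = c (z (e (i, true))) <;>
      simp [ψ, h0, h1, one_add_one_eq_two]
  calc ∑ σ : Fin m → Bool, errorWeight e G c (z ∘ swapIdx e σ)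
      ≤ ∑ σ : Fin m → Bool, ∑ w ∈ hfin.toFinset, ∏ j, ψ w (swapIdx e σ j) j :=
        Finset.sum_le_sum fun σ _ => step σ
    _ ≤ ∑ w ∈ hfin.toFinset, 2 ^ m := by
        rw [Finset.sum_comm]
        exact Finset.sum_le_sum fun w _ => pairs w
    _ = _ := by
        rw [Finset.sum_const, nsmul_eq_mul, mul_comm, splits, Set.ncard_eq_toFinset_card _ hfin]

theorem splits_le_two_pow {X : Type*} {n : ℕ} (G : Set (X → Bool)) (z : Fin n → X) : splits G z ≤ 2 ^ n := by
  refine (Set.ncard_le_card _).trans ?_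
  simp

variable {X : Type*} [MeasurableSpace X] {P : Measure X} [IsProbabilityMeasure P]
  {H : Set (X → Bool)} {χ : (X → Bool) → X → ℝ} {c : X → Bool}

theorem MeasurableClass.nullMeasurableSet_labels (hM : MeasurableClass P H χ c) (τ : ℝ) {n : ℕ}
    (B : Set (Fin n → Bool)) :
    NullMeasurableSet {z : Fin n → X | ∃ h ∈ compatClass P H χ τ, (fun j => h (z j)) ∈ B}
      (Measure.pi fun _ => P) := by
  have ho : IsOpen {p : (Fin n → Bool × ℝ) × ℝ × ℝ |
      1 - τ < p.2.2 ∧ (fun j => (p.1 j).1) ∈ B} := by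
    refine (isOpen_lt (g := fun p : (Fin n → Bool × ℝ) × ℝ × ℝ => p.2.2) continuous_const
      (by fun_prop)).inter ?_
    exact (isOpen_discrete B).preimage
      (f := fun p : (Fin n → Bool × ℝ) × ℝ × ℝ => fun j => (p.1 j).1) (by fun_prop)
  convert hM.event n _ ho using 1
  ext z
  simp [compatClass, and_assoc]

/-- The labels of `c` are not among the data of `MeasurableClass.event`; partitioning by their
finitely many values makes them constants. -/
theorem MeasurableClass.aemeasurable_errorWeight (hM : MeasurableClass P H χ c) (hc : c ∈ H)
    (τ : ℝ) {m n : ℕ} (e : Fin m × Bool ≃ Fin n) :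
    AEMeasurable (errorWeight e (compatClass P H χ τ) c) (Measure.pi fun _ => P) := by
  refine aemeasurable_of_nullMeasurableSet_lt fun a => ?_
  have : {z | a < errorWeight e (compatClass P H χ τ) c z} =
      ⋃ b : Fin n → Bool, {z | (fun j => c (z j)) = b} ∩
        {z | ∃ h ∈ compatClass P H χ τ, (fun j => h (z j)) ∈
          {w : Fin n → Bool | a < ∏ j, if w j = b j then 1 else
            if (e.symm j).2 then 2 else 0}} := by
    ext z
    simp [errorWeight, lt_iSup_iff]
  rw [this]
  refine NullMeasurableSet.iUnion fun b => .inter ?_ (hM.nullMeasurableSet_labels τ _)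
  have hmeas : Measurable fun z : Fin n → X => fun j => c (z j) :=
    measurable_pi_lambda _ fun j => (hM.hyp c hc).comp (measurable_pi_apply j)
  exact (hmeas (MeasurableSet.singleton b)).nullMeasurableSet

theorem MeasurableClass.integrable_splits (hM : MeasurableClass P H χ c) (τ : ℝ) (n : ℕ) :
    Integrable (fun z : Fin n → X => (splits (compatClass P H χ τ) z : ℝ))
      (Measure.pi fun _ => P) := by
  classical
  refine Integrable.of_bound (C := 2 ^ n) ?_ (Filter.Eventually.of_forall fun z => ?_)
  · have : (fun z : Fin n → X => (splits (compatClass P H χ τ) z : ℝ)) = fun z =>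
        ∑ b : Fin n → Bool, {z : Fin n → X | ∃ h ∈ compatClass P H χ τ,
          (fun j => h (z j)) ∈ ({b} : Set (Fin n → Bool))}.indicator (fun _ => (1 : ℝ)) z := by
      funext z
      rw [splits, Set.ncard_eq_toFinset_card _ (Set.toFinite _), Finset.card_eq_sum_ones,
        ← Finset.sum_subset (Finset.subset_univ (Set.toFinite
          ((fun (h : X → Bool) (i : Fin n) => h (z i)) '' compatClass P H χ τ)).toFinset)]
      · push_cast
        refine Finset.sum_congr rfl fun b hb => ?_
        rw [Set.Finite.mem_toFinset] at hb
        obtain ⟨h, hh, hb⟩ := hb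
        rw [Set.indicator_of_mem]
        exact ⟨h, hh, hb⟩
      · intro b _ hb
        rw [Set.Finite.mem_toFinset] at hb
        rw [Set.indicator_of_notMem]
        rintro ⟨h, hh, hz⟩
        exact hb ⟨h, hh, hz⟩
    rw [this]
    refine AEMeasurable.aestronglyMeasurable (Finset.aemeasurable_fun_sum _ fun b _ => ?_)
    exact aemeasurable_const.indicator₀ (hM.nullMeasurableSet_labels τ {b})
  · rw [Real.norm_eq_abs, abs_of_nonneg (Nat.cast_nonneg _)]
    exact_mod_cast splits_le_two_pow _ z

/-- The target supplies a labeling of every sample, so the logarithm in the labeled sample size has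
a positive argument. -/
theorem one_le_expSplits (hM : MeasurableClass P H χ c) {τ : ℝ}
    (hc : c ∈ compatClass P H χ τ) (n : ℕ) : 1 ≤ expSplits P (compatClass P H χ τ) n := by
  have h : ∫ _ : Fin n → X, (1 : ℝ) ∂(Measure.pi fun _ => P) ≤
      expSplits P (compatClass P H χ τ) n := by
    refine integral_mono (integrable_const _) (hM.integrable_splits τ n) fun z => ?_
    have : 0 < splits (compatClass P H χ τ) z :=
      (Set.ncard_pos (Set.toFinite _)).2 ⟨_, c, hc, rfl⟩
    exact Nat.one_le_cast.2 this
  simpa using h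

/-- One ghost point contributes the mean of `1 + 1[h ≠ c]`, and independence gives the power.
Consistency on `S` makes all factors from `S` equal to 1. -/
theorem le_lintegral_errorWeight (hM : MeasurableClass P H χ c) (hc : c ∈ H) {m n : ℕ}
    (e : Fin m × Bool ≃ Fin n) {G : Set (X → Bool)} {h : X → Bool} (hh : h ∈ G) (hH : h ∈ H)
    {S : Fin m → X} (hS : ∀ i, h (S i) = c (S i)) :
    ENNReal.ofReal ((1 + err P c h) ^ m) ≤
      ∫⁻ S', errorWeight e G c (glue e S S') ∂(Measure.pi fun _ => P) := by
  have hset : MeasurableSet {x | h x ≠ c x} :=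
    (measurableSet_eq_fun (hM.hyp h hH) (hM.hyp c hc)).compl
  let f : X → ℝ := fun x => 1 + {x | h x ≠ c x}.indicator (fun _ => 1) x
  have hf0 : ∀ x, 0 ≤ f x := fun x =>
    add_nonneg zero_le_one (Set.indicator_nonneg (fun _ _ => zero_le_one) x)
  have hi : Integrable ({x | h x ≠ c x}.indicator fun _ => (1 : ℝ)) P :=
    (integrable_const _).indicator hset
  have hf : Integrable f P := (integrable_const _).add hi
  have hfint : ∫ x, f x ∂P = 1 + err P c h := by
    rw [integral_add (integrable_const _) hi, integral_indicator_const _ hset]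
    simp [err]
  have hprod : ∀ S' : Fin m → X, ∏ i, ENNReal.ofReal (f (S' i)) ≤
      errorWeight e G c (glue e S S') := by
    intro S'
    refine le_trans (le_of_eq ?_) (le_iSup₂_of_le h hh le_rfl)
    rw [prod_eq_prod_pairs e]
    refine Finset.prod_congr rfl fun i _ => ?_
    by_cases hx : h (S' i) = c (S' i)
    · simp [glue, f, hx, hS]
    · simp [glue, f, hx, hS, one_add_one_eq_two]
  refine le_trans (le_of_eq ?_) (lintegral_mono hprod)
  rw [lintegral_pi_prod (fun _ : Fin m => P) (fun _ => f) (fun _ => hf) (fun _ => hf0),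
    Finset.prod_const, Finset.card_univ, Fintype.card_fin,
    ← ofReal_integral_eq_lintegral_ofReal hf (Filter.Eventually.of_forall hf0), hfint,
    ENNReal.ofReal_pow (add_nonneg zero_le_one (show 0 ≤ err P c h from measureReal_nonneg))]

/-- With `m` labeled examples, the probability that some hypothesis of `H_{P,χ}(τ)` of error more
than `ε` is consistent is at most `H_{P,χ}(τ)[2m, P] / (1 + ε) ^ m`. -/
theorem measure_exists_consistent_le (hM : MeasurableClass P H χ c) (hc : c ∈ H) (τ : ℝ)
    {ε : ℝ} (hε : 0 < ε) (m : ℕ) :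
    (Measure.pi fun _ : Fin m => P)
        {S | ∃ h ∈ compatClass P H χ τ, ε < err P c h ∧ ∀ i, h (S i) = c (S i)} ≤
      ENNReal.ofReal (expSplits P (compatClass P H χ τ) (2 * m) / (1 + ε) ^ m) := by
  have e : Fin m × Bool ≃ Fin (2 * m) := Fintype.equivFinOfCardEq (by simp [mul_comm])
  have key := mul_measure_le_lintegral_of_swap e P (errorWeight e (compatClass P H χ τ) c)
    (hM.aemeasurable_errorWeight hc τ e)
    {S | ∃ h ∈ compatClass P H χ τ, ε < err P c h ∧ ∀ i, h (S i) = c (S i)}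
    (ENNReal.ofReal ((1 + ε) ^ m))
    (by
      rintro S ⟨h, hh, hlt, hS⟩
      refine le_trans (ENNReal.ofReal_le_ofReal ?_)
        (le_lintegral_errorWeight hM hc e hh hh.1 hS)
      gcongr)
    (fun z => (splits (compatClass P H χ τ) z : ENNReal))
    (sum_errorWeight_le e _ c)
  have hs : ∫⁻ z : Fin (2 * m) → X, (splits (compatClass P H χ τ) z : ENNReal)
      ∂(Measure.pi fun _ => P) = ENNReal.ofReal (expSplits P (compatClass P H χ τ) (2 * m)) := by
    rw [expSplits, ofReal_integral_eq_lintegral_ofReal (hM.integrable_splits τ _)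
      (Filter.Eventually.of_forall fun _ => Nat.cast_nonneg _)]
    simp
  have hpos : 0 < (1 + ε) ^ m := by positivity
  rw [hs, mul_comm] at key
  rw [ENNReal.ofReal_div_of_pos hpos]
  rwa [ENNReal.le_div_iff_mul_le (Or.inl (by simpa using hpos)) (Or.inl ENNReal.ofReal_ne_top)]

end Consistency

/-! ### Sample sizes and the learning rule. -/

section Learning

/-- A consistent hypothesis whose empirical compatibility is maximal up to `γ`. -/
def IsNearlyMostCompatible {X : Type*} {ml mu : ℕ} (H : Set (X → Bool)) (χ : (X → Bool) → X → ℝ)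
    (γ : ℝ) (L : Fin ml → X × Bool) (S : Fin mu → X) (h : X → Bool) : Prop :=
  h ∈ consistent H L ∧ ∀ h' ∈ consistent H L, empCompat χ S h' ≤ empCompat χ S h + γ

theorem exists_isNearlyMostCompatible {X : Type*} {ml mu : ℕ} {H : Set (X → Bool)}
    {χ : (X → Bool) → X → ℝ} (hχ : ∀ h ∈ H, ∀ x, χ h x ∈ Set.Icc (0 : ℝ) 1) {γ : ℝ} (hγ : 0 < γ)
    {L : Fin ml → X × Bool} (hL : (consistent H L).Nonempty) (S : Fin mu → X) :
    ∃ h, IsNearlyMostCompatible H χ γ L S h := by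
  have hbdd : BddAbove (empCompat χ S '' consistent H L) := by
    refine ⟨1, ?_⟩
    rintro _ ⟨h, hh, rfl⟩
    refine div_le_one_of_le₀ ?_ (Nat.cast_nonneg _)
    simpa using Finset.sum_le_sum fun (i : Fin mu) (_ : i ∈ Finset.univ) => (hχ h hh.1 (S i)).2
  obtain ⟨_, ⟨h, hh, rfl⟩, hlt⟩ := exists_lt_of_lt_csSup (hL.image (empCompat χ S))
    (sub_lt_self (sSup (empCompat χ S '' consistent H L)) hγ)
  refine ⟨h, hh, fun h' hh' => ?_⟩
  linarith [le_csSup hbdd (Set.mem_image_of_mem (empCompat χ S) hh')]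

theorem eq_of_mem_consistent {X : Type*} {m : ℕ} {H : Set (X → Bool)} {c h : X → Bool}
    {x : Fin m → X} (hh : h ∈ consistent H (labelBy c x)) (i : Fin m) : h (x i) = c (x i) := by
  have h0 : empErr (labelBy c x) h = 0 := hh.2
  have hm : (m : ℝ) ≠ 0 := by
    have := i.pos
    positivity
  rw [empErr, div_eq_zero_iff, or_iff_left hm, Finset.sum_eq_zero_iff_of_nonneg
    fun _ _ => by split_ifs <;> norm_num] at h0
  by_contra hne
  have h1 := h0 i (Finset.mem_univ i)
  simp [labelBy, hne] at h1

theorem target_mem_consistent {X : Type*} {m : ℕ} {H : Set (X → Bool)} {c : X → Bool}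
    (hc : c ∈ H) (x : Fin m → X) : c ∈ consistent H (labelBy c x) :=
  ⟨hc, by simp [empErr, labelBy]⟩

/-- The terms in `m` add up to `-m * ε ^ 2 / 64`, and the logarithm of the growth term costs at most
`9 * d * log (1 / ε)`; hence `576 = 64 * 9`. -/
theorem exp_sample_size_le {d m : ℕ} {ε δ : ℝ} (hε : 0 < ε) (hε2 : ε ≤ 1 / 2) (hδ : 0 < δ)
    (hδ1 : δ < 1)
    (hm : 576 * (d / ε ^ 2 * Real.log (1 / ε) + 1 / ε ^ 2 * Real.log (2 / δ)) ≤ m) :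
    Real.exp (2 * m * (ε ^ 2 / 128) + d * Real.log (1 / (ε ^ 2 / 128)) + m * (ε / 4) ^ 2 / 2
      - m * (ε / 4) ^ 2) ≤ δ / 4 := by
  rw [← Real.le_log_iff_exp_le (by positivity)]
  have h1 : Real.log (1 / (ε ^ 2 / 128)) ≤ 9 * Real.log (1 / ε) := by
    rw [show (9 : ℝ) = (9 : ℕ) by norm_num, ← Real.log_pow]
    apply Real.log_le_log (by positivity)
    have h2 : (2 : ℝ) ≤ 1 / ε := by rw [le_div_iff₀ hε]; linarith
    calc 1 / (ε ^ 2 / 128) = 2 ^ 7 * (1 / ε) ^ 2 := by field_simp; norm_num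
      _ ≤ (1 / ε) ^ 7 * (1 / ε) ^ 2 := by gcongr
      _ = (1 / ε) ^ 9 := by ring
  have h3 : Real.log (δ / 4) = -(2 * Real.log (2 / δ)) + Real.log (1 / δ) := by
    rw [Real.log_div hδ.ne' (by norm_num), Real.log_div (by norm_num) hδ.ne',
      Real.log_div one_ne_zero hδ.ne', show (4 : ℝ) = 2 ^ 2 by norm_num, Real.log_pow]
    simp
    ring
  have h4 : 0 ≤ Real.log (1 / δ) := Real.log_nonneg (by rw [le_div_iff₀ hδ]; linarith)
  have h5 : 0 < Real.log (2 / δ) := Real.log_pos (by rw [lt_div_iff₀ hδ]; linarith)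
  have h6 : 576 * (d * Real.log (1 / ε) + Real.log (2 / δ)) ≤ m * ε ^ 2 := by
    calc 576 * (d * Real.log (1 / ε) + Real.log (2 / δ))
        = 576 * (d / ε ^ 2 * Real.log (1 / ε) + 1 / ε ^ 2 * Real.log (2 / δ)) * ε ^ 2 := by
          field_simp
      _ ≤ m * ε ^ 2 := by gcongr
  have h7 : d * Real.log (1 / (ε ^ 2 / 128)) ≤ d * (9 * Real.log (1 / ε)) := by gcongr
  rw [h3]
  linarith

theorem splits_div_pow_le {m : ℕ} {N ε δ : ℝ} (hN : 1 ≤ N) (hε : 0 < ε) (hε1 : ε < 1)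
    (hδ : 0 < δ) (hm : 2 / ε * (Real.log (2 * N) + Real.log (4 / δ)) ≤ m) :
    N / (1 + ε) ^ m ≤ δ / 8 := by
  have h1 : Real.log (8 * N / δ) ≤ m * (ε / 2) := by
    have h : Real.log (8 * N / δ) = Real.log (2 * N) + Real.log (4 / δ) := by
      rw [← Real.log_mul (by positivity) (by positivity)]
      congr 1
      ring
    calc Real.log (8 * N / δ)
        = 2 / ε * (Real.log (2 * N) + Real.log (4 / δ)) * (ε / 2) := by
          rw [h]
          field_simp
      _ ≤ m * (ε / 2) := by gcongr
  -- Through `exp (ε / 2) ≤ 1 / (1 - ε / 2)`, using `ε < 1`.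
  have h2 : Real.exp (ε / 2) ≤ 1 + ε := by
    refine (Real.exp_bound_div_one_sub_of_interval (by positivity) (by linarith)).trans ?_
    rw [div_le_iff₀ (by linarith)]
    nlinarith
  have h3 : 8 * N / δ ≤ (1 + ε) ^ m :=
    calc 8 * N / δ = Real.exp (Real.log (8 * N / δ)) := (Real.exp_log (by positivity)).symm
      _ ≤ Real.exp (m * (ε / 2)) := Real.exp_le_exp.2 h1
      _ = Real.exp (ε / 2) ^ m := Real.exp_nat_mul _ _
      _ ≤ (1 + ε) ^ m := by gcongr
  rw [div_le_iff₀ hδ] at h3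
  rw [div_le_iff₀ (by positivity)]
  linarith

variable {X : Type*} [MeasurableSpace X] {P : Measure X} [IsProbabilityMeasure P]
  {H : Set (X → Bool)} {χ : (X → Bool) → X → ℝ} {c : X → Bool}

theorem compat_mem_Icc (hχ : ∀ h ∈ H, ∀ x, χ h x ∈ Set.Icc (0 : ℝ) 1) {h : X → Bool}
    (hh : h ∈ H) : compat P χ h ∈ Set.Icc (0 : ℝ) 1 := by
  refine ⟨integral_nonneg fun x => (hχ h hh x).1, ?_⟩
  have := integral_mono_of_nonneg (μ := P) (Filter.Eventually.of_forall fun x => (hχ h hh x).1)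
    (integrable_const (1 : ℝ)) (Filter.Eventually.of_forall fun x => (hχ h hh x).2)
  simpa [compat] using this

/-- Uniform convergence of the empirical compatibilities, up to `ε / 4`. -/
theorem measure_exists_compat_deviation_le (hM : MeasurableClass P H χ c)
    (hχ : ∀ h ∈ H, ∀ x, χ h x ∈ Set.Icc (0 : ℝ) 1) {d : ℕ} (hd : VCdim (χ '' H) = d)
    {ε δ : ℝ} (hε : 0 < ε) (hε2 : ε ≤ 1 / 2) (hδ : 0 < δ) (hδ1 : δ < 1) {m : ℕ}
    (hm : 576 * (d / ε ^ 2 * Real.log (1 / ε) + 1 / ε ^ 2 * Real.log (2 / δ)) ≤ m) :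
    (Measure.pi fun _ : Fin m => P)
        {S | ∃ h ∈ H, ε / 4 ≤ |empCompat χ S h - compat P χ h|} ≤ ENNReal.ofReal (δ / 2) := by
  have hm0 : (0 : ℝ) < m := by
    have h1 : 0 ≤ Real.log (1 / ε) := Real.log_nonneg (by rw [le_div_iff₀ hε]; linarith)
    have h2 : 0 < Real.log (2 / δ) := Real.log_pos (by rw [lt_div_iff₀ hδ]; linarith)
    refine lt_of_lt_of_le ?_ hm
    positivity
  have hy1 : ε ^ 2 / 128 ≤ 1 := by nlinarith
  -- The choice `l = ± ε / 4` minimizes the Chernoff exponent `m * l ^ 2 / 2 - |l| * m * ε / 4`.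
  have side : ∀ l : ℝ, l ^ 2 = (ε / 4) ^ 2 → (Measure.pi fun _ : Fin m => P)
      {S | ∃ h ∈ H, m * (ε / 4) ^ 2 ≤ l * (∑ i, χ h (S i) - m * compat P χ h)} ≤
        ENNReal.ofReal (δ / 4) := by
    intro l hl
    refine (measure_exists_deviation_le hM hχ hd m l _ (y := ε ^ 2 / 128)
      (by positivity) hy1).trans (ENNReal.ofReal_le_ofReal ?_)
    rw [hl]
    exact exp_sample_size_le hε hε2 hδ hδ1 hm
  have hsub : {S : Fin m → X | ∃ h ∈ H, ε / 4 ≤ |empCompat χ S h - compat P χ h|} ⊆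
      {S | ∃ h ∈ H, m * (ε / 4) ^ 2 ≤ (ε / 4) * (∑ i, χ h (S i) - m * compat P χ h)} ∪
      {S | ∃ h ∈ H, m * (ε / 4) ^ 2 ≤ -(ε / 4) * (∑ i, χ h (S i) - m * compat P χ h)} := by
    rintro S ⟨h, hh, hdev⟩
    have hsum : ∑ i, χ h (S i) = m * empCompat χ S h := by
      rw [empCompat, mul_div_cancel₀ _ hm0.ne']
    have hmul : (0 : ℝ) < m * (ε / 4) := by positivity
    rcases le_abs.1 hdev with h1 | h1
    · refine Or.inl ⟨h, hh, ?_⟩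
      rw [hsum]
      nlinarith [mul_le_mul_of_nonneg_left h1 hmul.le]
    · refine Or.inr ⟨h, hh, ?_⟩
      rw [hsum]
      nlinarith [mul_le_mul_of_nonneg_left h1 hmul.le]
  refine (measure_mono hsub).trans ((measure_union_le _ _).trans
    ((add_le_add (side _ rfl) (side _ (by ring))).trans_eq ?_))
  rw [← ENNReal.ofReal_add (by positivity) (by positivity)]
  ring_nf

/-- With probability at least `1 - δ`, every consistent hypothesis whose empirical compatibility is
maximal up to `ε / 4` has error at most `ε`. -/
theorem measure_exists_isNearlyMostCompatible_le
    (hχ : ∀ h ∈ H, ∀ x, χ h x ∈ Set.Icc (0 : ℝ) 1) {d : ℕ} (hd : VCdim (χ '' H) = d)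
    {ε δ : ℝ} (hε : 0 < ε) (hδ : 0 < δ) {mu ml : ℕ}
    (hmu : 576 * (d / ε ^ 2 * Real.log (1 / ε) + 1 / ε ^ 2 * Real.log (2 / δ)) ≤ mu) {t : ℝ}
    (hM : MeasurableClass P H χ c) (hc : c ∈ H) (ht : compat P χ c = 1 - t)
    (hml : 2 / ε * (Real.log (2 * expSplits P (compatClass P H χ (t + 2 * ε)) (2 * ml))
      + Real.log (4 / δ)) ≤ ml) :
    ((Measure.pi fun _ : Fin mu => P).prod (Measure.pi fun _ : Fin ml => P))
      {ω | ∃ h, IsNearlyMostCompatible H χ (ε / 4) (labelBy c ω.2) ω.1 h ∧ ε < err P c h} ≤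
        ENNReal.ofReal δ := by
  rcases le_or_gt 1 δ with hδ1 | hδ1
  · exact prob_le_one.trans (ENNReal.one_le_ofReal.2 hδ1)
  rcases le_or_gt 1 ε with hε1 | hε1
  · rw [Set.eq_empty_of_forall_notMem (s := {ω | ∃ h, _}) fun ω hω => ?_]
    · simp
    · obtain ⟨h, -, hlt⟩ := hω
      exact absurd hlt (not_lt.2 (measureReal_le_one.trans hε1))
  set μu := Measure.pi fun _ : Fin mu => P
  set μl := Measure.pi fun _ : Fin ml => P
  set Bl : Set (Fin ml → X) := {S | ∃ h ∈ compatClass P H χ (t + 2 * ε), ε < err P c h ∧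
    ∀ i, h (S i) = c (S i)} with hBl
  have hcG : c ∈ compatClass P H χ (t + 2 * ε) := ⟨hc, by rw [ht]; linarith⟩
  have hBlm : μl Bl ≤ ENNReal.ofReal (δ / 8) :=
    (measure_exists_consistent_le hM hc (t + 2 * ε) hε ml).trans (ENNReal.ofReal_le_ofReal
      (splits_div_pow_le (one_le_expSplits hM hcG _) hε hε1 hδ hml))
  have hprodl : (μu.prod μl) (Set.univ ×ˢ Bl) = μl Bl := by
    rw [Measure.prod_prod, measure_univ, one_mul]
  -- For `ε > 1 / 2` the unlabeled sample is not needed: `t ≥ 0` gives `1 - (t + 2 * ε) < 0`, so the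
  -- compatibility class is all of `H`.
  rcases le_or_gt ε (1 / 2) with hε2 | hε2
  · set Bu : Set (Fin mu → X) := {S | ∃ h ∈ H, ε / 4 ≤ |empCompat χ S h - compat P χ h|}
      with hBu
    have hBum : μu Bu ≤ ENNReal.ofReal (δ / 2) :=
      measure_exists_compat_deviation_le hM hχ hd hε hε2 hδ hδ1 hmu
    have hprodu : (μu.prod μl) (Bu ×ˢ Set.univ) = μu Bu := by
      rw [Measure.prod_prod, measure_univ, mul_one]
    have hsub : {ω : (Fin mu → X) × (Fin ml → X) |
        ∃ h, IsNearlyMostCompatible H χ (ε / 4) (labelBy c ω.2) ω.1 h ∧ ε < err P c h} ⊆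
        Bu ×ˢ Set.univ ∪ Set.univ ×ˢ Bl := by
      rintro ω ⟨h, hnear, hlt⟩
      by_cases hω : ω.1 ∈ Bu
      · exact Or.inl ⟨hω, Set.mem_univ _⟩
      · refine Or.inr ⟨Set.mem_univ _, h, ⟨hnear.1.1, ?_⟩, hlt, eq_of_mem_consistent hnear.1⟩
        have hdev : ∀ h ∈ H, |empCompat χ ω.1 h - compat P χ h| < ε / 4 := fun h hh =>
          not_le.1 fun hle => hω ⟨h, hh, hle⟩
        have h1 := (abs_lt.1 (hdev h hnear.1.1)).2
        have h2 := (abs_lt.1 (hdev c hc)).1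
        have h3 := hnear.2 c (target_mem_consistent hc ω.2)
        linarith
    calc (μu.prod μl) _ ≤ (μu.prod μl) (Bu ×ˢ Set.univ) + (μu.prod μl) (Set.univ ×ˢ Bl) :=
          (measure_mono hsub).trans (measure_union_le _ _)
      _ ≤ ENNReal.ofReal (δ / 2) + ENNReal.ofReal (δ / 8) := by
          rw [hprodu, hprodl]
          exact add_le_add hBum hBlm
      _ ≤ ENNReal.ofReal δ := by
          rw [← ENNReal.ofReal_add (by positivity) (by positivity)]
          exact ENNReal.ofReal_le_ofReal (by linarith)
  · have hsub : {ω : (Fin mu → X) × (Fin ml → X) |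
        ∃ h, IsNearlyMostCompatible H χ (ε / 4) (labelBy c ω.2) ω.1 h ∧ ε < err P c h} ⊆
        Set.univ ×ˢ Bl := by
      rintro ω ⟨h, hnear, hlt⟩
      refine ⟨Set.mem_univ _, h, ⟨hnear.1.1, ?_⟩, hlt, eq_of_mem_consistent hnear.1⟩
      have h1 := (compat_mem_Icc (P := P) hχ hnear.1.1).1
      have h2 := (compat_mem_Icc (P := P) hχ hc).2
      linarith
    exact (measure_mono hsub).trans (hprodl.le.trans (hBlm.trans
      (ENNReal.ofReal_le_ofReal (by linarith))))

end Learning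

end SSL

/-- The constant `C` is universal, and the learner `A` sees only the two samples (it depends on
`H`, `χ`, `ε`, `δ` and the sample sizes, not on `P`, the target `c` or `t`). "With probability at
least `1 - δ`" says that the failure set has (outer) measure at most `δ` under the joint law of an
i.i.d. unlabeled sample `ω.1` and an independent i.i.d. sample `ω.2`, labeled by `c`. -/
theorem theorem1 :
    ∃ C : ℝ, 0 < C ∧
      ∀ (X : Type*) [MeasurableSpace X] (H : Set (X → Bool)) (χ : (X → Bool) → X → ℝ),
        (∀ h ∈ H, ∀ x, χ h x ∈ Set.Icc (0 : ℝ) 1) →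
        ∀ (d : ℕ), SSL.VCdim (χ '' H) = d →
        ∀ (ε δ : ℝ), 0 < ε → 0 < δ →
        ∀ (mu ml : ℕ),
          C * (d / ε ^ 2 * Real.log (1 / ε) + 1 / ε ^ 2 * Real.log (2 / δ)) ≤ mu →
          ∃ A : (Fin ml → X × Bool) → (Fin mu → X) → (X → Bool),
            ∀ (P : MeasureTheory.Measure X) [MeasureTheory.IsProbabilityMeasure P]
              (c : X → Bool) (t : ℝ),
              SSL.MeasurableClass P H χ c →
              c ∈ H → SSL.compat P χ c = 1 - t →
              2 / ε * (Real.log (2 * SSL.expSplits P (SSL.compatClass P H χ (t + 2 * ε)) (2 * ml))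
                + Real.log (4 / δ)) ≤ ml →
              -- the sample sizes suffice to learn to error `ε` with probability `1 - δ`
              ((MeasureTheory.Measure.pi fun _ : Fin mu => P).prod
                  (MeasureTheory.Measure.pi fun _ : Fin ml => P))
                {ω | ¬ (A (SSL.labelBy c ω.2) ω.1 ∈ SSL.consistent H (SSL.labelBy c ω.2) ∧
                  SSL.err P c (A (SSL.labelBy c ω.2) ω.1) ≤ ε)} ≤ ENNReal.ofReal δ ∧
              -- every consistent hypothesis of maximal empirical compatibility has error `≤ ε`
              ((MeasureTheory.Measure.pi fun _ : Fin mu => P).prod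
                  (MeasureTheory.Measure.pi fun _ : Fin ml => P))
                {ω | ¬ ∀ h, SSL.IsMostCompatible H χ (SSL.labelBy c ω.2) ω.1 h →
                  SSL.err P c h ≤ ε} ≤ ENNReal.ofReal δ := by
  classical
  refine ⟨576, by norm_num, ?_⟩
  intro X _ H χ hχ d hd ε δ hε hδ mu ml hmu
  -- The default branch never occurs on samples labeled by a target in `H`: the target is
  -- consistent, so a near maximizer exists.
  refine ⟨fun L S => if hex : ∃ h, SSL.IsNearlyMostCompatible H χ (ε / 4) L S h then hex.choose
    else fun _ => false, ?_⟩
  intro P _ c t hM hc ht hml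
  have key := SSL.measure_exists_isNearlyMostCompatible_le hχ hd hε hδ hmu hM hc ht hml
  constructor
  · refine (MeasureTheory.measure_mono fun ω hω => ?_).trans key
    have hex := SSL.exists_isNearlyMostCompatible hχ (show 0 < ε / 4 by positivity)
      ⟨c, SSL.target_mem_consistent hc ω.2⟩ ω.1
    simp only [Set.mem_ofPred_eq, dif_pos hex] at hω
    exact ⟨hex.choose, hex.choose_spec,
      not_le.1 fun hle => hω ⟨hex.choose_spec.1, hle⟩⟩
  · refine (MeasureTheory.measure_mono fun ω hω => ?_).trans key
    simp only [Set.mem_ofPred_eq, not_forall, not_le] at hω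
    obtain ⟨h, hmost, hlt⟩ := hω
    exact ⟨h, ⟨hmost.1, fun h' hh' => (hmost.2 h' hh').trans (by linarith)⟩, hlt⟩
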